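/- Let $p$ be a prime with $p\equiv 1 \pmod 4$, let $\pi\in\mathbb Z[i]$ with $N(\pi)=\pi\overline\pi=p$, and let $G_\pi=\mathbb Z[i]/(\pi)$, a field with $p$ elements. Each class $\gamma\in G_\pi$ has a reduced representative $\zeta-[\zeta\overline\pi/p]\,\pi$ ($\zeta\in\gamma$ arbitrary, $[\cdot]$ rounding real and imaginary parts to the closest integer); write $w_M(\gamma)=|\mathrm{Re}|+|\mathrm{Im}|$ of this representative. For $(u|v)\in G_\pi^{2n}$ put $wt_M(u|v)=\left\lceil \tfrac12\sum_{j}\bigl(w_M(u_j)+w_M(v_j)\bigr)\right\rceil$ and $(u|v)*(u'|v')=v\cdot u'-v'\cdot u$; for a linear code $C\subseteq G_\pi^{2n}$ let $C^{\perp_*}$ be its dual for $*$. Let $\xi$ be a primitive $p$-th root of unity and let $(\mathbb C^p)^{\otimes n}$ have the orthonormal basis $|u\rangle$, $u\in G_\pi^n$. For $a,b\in G_\pi^n$ let $X_a|u\rangle=|a+u\rangle$ and $Z_b|u\rangle=\xi^{\mu^{-1}(b\cdot u)}|u\rangle$, where $\mu^{-1}:G_\pi\to\mathbb F_p$ is the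 canonical isomorphism. A quantum code is a subspace $Q\subseteq(\mathbb C^p)^{\otimes n}$; with $P$ the orthogonal projection onto $Q$, it detects an operator $E$ if $PEP$ is a scalar multiple of $P$; its minimum (Mannheim) distance is the least $wt_M(a|b)$ of an error $X_aZ_b$ that it does not detect. Let $C_1,C_2\subseteq G_\pi^n$ be linear codes, $C_1^\perp$ the dual of $C_1$ for the usual inner product $u\cdot v=\sum_j u_jv_j$, and let $C=(C_2|C_1^\perp)=\{(u|v):u\in C_2,\ v\in C_1^\perp\}\subseteq G_\pi^{2n}$ satisfy $C\subseteq C^{\perp_*}$. Then $K=\dim C^{\perp_*}-\dim C$ is even, and there is a quantum code $Q\subseteq(\mathbb C^p)^{\otimes n}$ of dimension $p^{K/2}$, i.e. an $[[n,K/2,d_M]]_\pi$ code, whose minimum distance, if $C\ne C^{\perp_*}$, is $$d_M=\min\{wt_M(w):\ w\in C^{\perp_*}\setminus C\}.$$ Moreover, $Q$ contains a $K$-dimensional subspace which, if $C\ne C^{\perp_*}$, has the same minimum distance $d_M$. -/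

import Mathlib

namespace MannheimQuantum

/-- The residue class ring `G_π = ℤ[i] / (π)` of the Gaussian integers. -/
abbrev Gres (π : GaussianInt) : Type := GaussianInt ⧸ Ideal.span {π}

/-- The reduction `ζ mod π = ζ - [ζ π̄ / (π π̄)] π`, where `[·]` rounds the real and the imaginary
part to the closest integer (see `reduce_eq`). -/
def reduce (π ζ : GaussianInt) : GaussianInt := ζ % π

theorem reduce_eq (π ζ : GaussianInt) :
    reduce π ζ = ζ - (⟨round ((ζ * star π).re / (Zsqrtd.norm π : ℚ)),
      round ((ζ * star π).im / (Zsqrtd.norm π : ℚ))⟩ : GaussianInt) * π := by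
  rw [reduce, GaussianInt.mod_def, GaussianInt.div_def, mul_comm]

theorem mk_reduce (π ζ : GaussianInt) :
    Ideal.Quotient.mk (Ideal.span {π}) (reduce π ζ) = Ideal.Quotient.mk (Ideal.span {π}) ζ := by
  rw [Ideal.Quotient.eq, Ideal.mem_span_singleton, reduce, GaussianInt.mod_def]
  exact ⟨-(ζ / π), by ring⟩

/-- The reduction depends on the residue class only. -/
theorem reduce_congr {π : GaussianInt} (hπ : π ≠ 0) {ζ ζ' : GaussianInt}
    (h : Ideal.Quotient.mk (Ideal.span {π}) ζ = Ideal.Quotient.mk (Ideal.span {π}) ζ') :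
    reduce π ζ = reduce π ζ' := by
  rw [Ideal.Quotient.eq, Ideal.mem_span_singleton] at h
  obtain ⟨k, hk⟩ := h
  obtain rfl : ζ = ζ' + π * k := by rw [← hk]; ring
  have hN : (Zsqrtd.norm π : ℚ) ≠ 0 := by
    exact_mod_cast fun h => hπ (GaussianInt.norm_eq_zero.1 h)
  have hmul : (ζ' + π * k) * star π = ζ' * star π + k * (Zsqrtd.norm π : GaussianInt) := by
    rw [Zsqrtd.norm_eq_mul_conj]; ring
  rw [reduce_eq, reduce_eq, hmul]
  have h1 : ((ζ' * star π + k * (Zsqrtd.norm π : GaussianInt)).re : ℚ) / (Zsqrtd.norm π : ℚ)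
      = (ζ' * star π).re / (Zsqrtd.norm π : ℚ) + (k.re : ℤ) := by
    field_simp; simp [mul_comm]
  have h2 : ((ζ' * star π + k * (Zsqrtd.norm π : GaussianInt)).im : ℚ) / (Zsqrtd.norm π : ℚ)
      = (ζ' * star π).im / (Zsqrtd.norm π : ℚ) + (k.im : ℤ) := by
    field_simp; simp [mul_comm]
  rw [h1, h2, round_add_intCast, round_add_intCast]
  ext <;> simp <;> ring

/-- The Mannheim weight `|Re γ| + |Im γ|` of a residue class, where `γ` is its reduced
representative (see `mannheimWeight_mk`). -/
noncomputable def mannheimWeight {π : GaussianInt} (x : Gres π) : ℕ :=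
  (reduce π (Quotient.out x)).re.natAbs + (reduce π (Quotient.out x)).im.natAbs

theorem mannheimWeight_mk {π : GaussianInt} (hπ : π ≠ 0) (ζ : GaussianInt) :
    mannheimWeight (Ideal.Quotient.mk (Ideal.span {π}) ζ) =
      (reduce π ζ).re.natAbs + (reduce π ζ).im.natAbs := by
  have h : reduce π (Quotient.out (Ideal.Quotient.mk (Ideal.span {π}) ζ)) = reduce π ζ :=
    reduce_congr hπ (Quotient.out_eq _)
  rw [mannheimWeight, h]

instance instFiniteGres (π : GaussianInt) [NeZero π] : Finite (Gres π) := by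
  have hπ : π ≠ 0 := NeZero.ne π
  let N : ℤ := Zsqrtd.norm π
  let f : (Set.Icc (-N) N) × (Set.Icc (-N) N) → Gres π :=
    fun q => Ideal.Quotient.mk _ (⟨q.1, q.2⟩ : GaussianInt)
  refine Finite.of_surjective f fun x => ?_
  obtain ⟨ζ, rfl⟩ := Ideal.Quotient.mk_surjective x
  have h := GaussianInt.norm_mod_lt ζ hπ
  rw [Zsqrtd.norm_def] at h
  have hr : (ζ % π).re ∈ Set.Icc (-N) N := by
    constructor <;> nlinarith [sq_nonneg (ζ % π).im, sq_nonneg ((ζ % π).re - 1),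
      sq_nonneg ((ζ % π).re + 1), h]
  have hi : (ζ % π).im ∈ Set.Icc (-N) N := by
    constructor <;> nlinarith [sq_nonneg (ζ % π).re, sq_nonneg ((ζ % π).im - 1),
      sq_nonneg ((ζ % π).im + 1), h]
  exact ⟨(⟨_, hr⟩, ⟨_, hi⟩), mk_reduce π ζ⟩

noncomputable instance instFintypeGres (π : GaussianInt) [NeZero π] : Fintype (Gres π) :=
  Fintype.ofFinite _

/-- The space `G_π^{2n}` of pairs `(u | v)`. -/
abbrev Pairs (π : GaussianInt) (n : ℕ) : Type := (Fin n → Gres π) × (Fin n → Gres π)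

/-- The symplectic form `(u | v) * (u' | v') = v · u' - v' · u`. -/
def sympl {π : GaussianInt} {n : ℕ} (w w' : Pairs π n) : Gres π :=
  w.2 ⬝ᵥ w'.1 - w'.2 ⬝ᵥ w.1

/-- The dual `C^⊥` of a linear code for the usual inner product. -/
def dualCode {π : GaussianInt} {n : ℕ} (C : Submodule (Gres π) (Fin n → Gres π)) :
    Submodule (Gres π) (Fin n → Gres π) where
  carrier := {v | ∀ u ∈ C, v ⬝ᵥ u = 0}
  zero_mem' := by intro u _; simp
  add_mem' := by
    intro v v' hv hv' u hu
    rw [add_dotProduct, hv u hu, hv' u hu, add_zero]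
  smul_mem' := by
    intro c v hv u hu
    rw [smul_dotProduct, hv u hu, smul_zero]

/-- The dual `C^{⊥*}` of a linear code in `G_π^{2n}` for the symplectic form. -/
def symplDual {π : GaussianInt} {n : ℕ} (C : Submodule (Gres π) (Pairs π n)) :
    Submodule (Gres π) (Pairs π n) where
  carrier := {w | ∀ w' ∈ C, sympl w w' = 0}
  zero_mem' := by intro w' _; simp [sympl]
  add_mem' := by
    intro w z hw hz w' hw'
    have h1 := hw w' hw'
    have h2 := hz w' hw'
    simp only [sympl, Prod.fst_add, Prod.snd_add, add_dotProduct, dotProduct_add] at h1 h2 ⊢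
    linear_combination h1 + h2
  smul_mem' := by
    intro c w hw w' hw'
    have h1 := hw w' hw'
    simp only [sympl, Prod.smul_fst, Prod.smul_snd, smul_dotProduct, dotProduct_smul,
      smul_eq_mul] at h1 ⊢
    linear_combination c * h1

/-- The Mannheim weight `wt_M` on `G_π^{2n}`: half the sum of the Mannheim weights of all
coordinates, rounded up. -/
noncomputable def wtM {π : GaussianInt} {n : ℕ} (w : Pairs π n) : ℕ :=
  ⌈((∑ i, (mannheimWeight (w.1 i) : ℚ)) + ∑ i, (mannheimWeight (w.2 i) : ℚ)) / 2⌉₊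

/-- The Hilbert space `(ℂ^p)^{⊗ n}`, with orthonormal basis `|u⟩`, `u ∈ G_π^n`. -/
abbrev HSpace (π : GaussianInt) [NeZero π] (n : ℕ) : Type :=
  EuclideanSpace ℂ (Fin n → Gres π)

/-- The inverse of `μ : F_p → G_π`: the least natural number in the class `x`
(it exists if `π π̄` is a prime, see `natCast_muInv`, and is then smaller than that prime). -/
noncomputable def muInv {π : GaussianInt} (x : Gres π) : ℕ := sInf {g : ℕ | (g : Gres π) = x}

theorem natCast_muInv {π : GaussianInt} {p : ℕ} (hp : p.Prime) (hπ : Zsqrtd.norm π = p)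
    (x : Gres π) : ((muInv x : ℕ) : Gres π) = x := by
  suffices h : {g : ℕ | (g : Gres π) = x}.Nonempty from Nat.sInf_mem h
  obtain ⟨a, ha⟩ : ∃ a, a = π.re := ⟨_, rfl⟩
  obtain ⟨b, hb0⟩ : ∃ b, b = π.im := ⟨_, rfl⟩
  have hab : a * a + b * b = p := by
    rw [Zsqrtd.norm_def] at hπ; subst ha hb0; linear_combination hπ
  have hpr : Prime (p : ℤ) := Nat.prime_iff_prime_int.1 hp
  have hb : ¬ (p : ℤ) ∣ b := by
    rintro ⟨k, hk⟩
    have h2 : (p : ℤ) ∣ a := by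
      have : (p : ℤ) ∣ a * a := ⟨1 - k * (p * k), by rw [hk] at hab; linear_combination hab⟩
      exact (hpr.dvd_or_dvd this).elim id id
    obtain ⟨l, hl⟩ := h2
    have h3 : (p : ℤ) * (l * l * p + k * k * p) = p * 1 := by
      rw [hk, hl] at hab; linear_combination hab
    have h4 := mul_left_cancel₀ hpr.ne_zero h3
    exact hpr.not_isUnit (IsUnit.of_mul_eq_one (l * l + k * k) (by linear_combination h4))
  obtain ⟨c, d, hcd⟩ := (hpr.coprime_iff_not_dvd.2 hb)
  let q : GaussianInt →+* Gres π := Ideal.Quotient.mk (Ideal.span {π})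
  have hqπ : q π = 0 := Ideal.Quotient.eq_zero_iff_mem.2 (Ideal.mem_span_singleton_self π)
  have hqp : (p : Gres π) = 0 := by
    have h5 : ((p : ℤ) : GaussianInt) = π * star π := by
      rw [← hπ, Zsqrtd.norm_eq_mul_conj]
    have h6 : q ((p : ℤ) : GaussianInt) = 0 := by rw [h5, map_mul, hqπ, zero_mul]
    simpa using h6
  let I : GaussianInt := ⟨0, 1⟩
  have hdec : ∀ z : GaussianInt, q z = (z.re : Gres π) + (z.im : Gres π) * q I := by
    intro z
    have hz : z = (z.re : GaussianInt) + (z.im : GaussianInt) * I := by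
      ext <;> simp [I]
    conv_lhs => rw [hz]
    simp
  have hI : q I = ((-(d * a) : ℤ) : Gres π) := by
    have h7 := hdec π
    rw [hqπ] at h7
    have h8 : (c : Gres π) * (p : Gres π) + (d : Gres π) * (b : Gres π) = 1 := by
      have := congrArg (Int.cast : ℤ → Gres π) hcd
      simpa using this
    push_cast
    rw [← ha, ← hb0] at h7
    linear_combination (-(q I)) * h8 + (c : Gres π) * q I * hqp - (d : Gres π) * h7
  obtain ⟨z, rfl⟩ := Ideal.Quotient.mk_surjective x
  let m : ℤ := z.re + z.im * (-(d * a))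
  have hm : (m : Gres π) = q z := by rw [hdec z, hI]; simp [m]
  refine ⟨(m % p).toNat, ?_⟩
  have hp0 : (p : ℤ) ≠ 0 := hpr.ne_zero
  have h9 : (((m % p).toNat : ℤ) : Gres π) = (m : Gres π) := by
    rw [Int.toNat_of_nonneg (Int.emod_nonneg _ hp0)]
    conv_rhs => rw [← Int.emod_add_mul_ediv m p]
    simp [hqp]
  change (((m % p).toNat : ℕ) : Gres π) = q z
  rw [← hm, ← h9]
  exact (Int.cast_natCast _).symm

/-- The tensor product `X_a` of the shifts `|u_i⟩ ↦ |a_i + u_i⟩` (see `shiftOp_ket`). -/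
noncomputable def shiftOp {π : GaussianInt} [NeZero π] {n : ℕ} (a : Fin n → Gres π) :
    HSpace π n →ₗ[ℂ] HSpace π n where
  toFun ψ := WithLp.toLp 2 fun u => ψ (u - a)
  map_add' ψ φ := by ext u; simp
  map_smul' c ψ := by ext u; simp

/-- The tensor product `Z_b` of the phase operators `|u_i⟩ ↦ ξ ^ μ⁻¹(b_i u_i) |u_i⟩`
(see `phaseOp_ket`). -/
noncomputable def phaseOp {π : GaussianInt} [NeZero π] {n : ℕ} (ξ : ℂ) (b : Fin n → Gres π) :
    HSpace π n →ₗ[ℂ] HSpace π n where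
  toFun ψ := WithLp.toLp 2 fun u => (∏ i, ξ ^ muInv (b i * u i)) * ψ u
  map_add' ψ φ := by ext u; simp [mul_add]
  map_smul' c ψ := by ext u; simp; ring

open Classical in
theorem shiftOp_ket {π : GaussianInt} [NeZero π] {n : ℕ} (a u : Fin n → Gres π) :
    shiftOp a (EuclideanSpace.single u (1 : ℂ)) = EuclideanSpace.single (a + u) 1 := by
  ext v
  simp [shiftOp, sub_eq_iff_eq_add, add_comm]

open Classical in
theorem phaseOp_ket {π : GaussianInt} [NeZero π] {n : ℕ} (ξ : ℂ) (b u : Fin n → Gres π) :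
    phaseOp ξ b (EuclideanSpace.single u (1 : ℂ)) =
      (∏ i, ξ ^ muInv (b i * u i)) • EuclideanSpace.single u 1 := by
  ext v
  by_cases h : v = u
  · subst h; simp [phaseOp]
  · simp [phaseOp, h]

/-- The error operator `X_a Z_b` with label `(a | b)`. -/
noncomputable def errorOp {π : GaussianInt} [NeZero π] {n : ℕ} (ξ : ℂ) (w : Pairs π n) :
    HSpace π n →ₗ[ℂ] HSpace π n :=
  shiftOp w.1 ∘ₗ phaseOp ξ w.2

/-- The quantum code `Q` detects the error `E`: `P E P = c P` for a scalar `c`, where `P` is the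
orthogonal projection onto `Q`. -/
def Detects {π : GaussianInt} [NeZero π] {n : ℕ} (Q : Submodule ℂ (HSpace π n))
    (E : HSpace π n →ₗ[ℂ] HSpace π n) : Prop :=
  ∃ c : ℂ, ∀ x ∈ Q, ∀ y ∈ Q, inner ℂ x (E y) = c * inner ℂ x y

/-- `d` is the minimum distance of the quantum code `Q` for the Mannheim weight: all errors
`X_a Z_b` with `wt_M (a | b) < d` are detected, and some error with `wt_M (a | b) = d` is not. -/
def HasMinDist {π : GaussianInt} [NeZero π] {n : ℕ} (ξ : ℂ) (Q : Submodule ℂ (HSpace π n))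
    (d : ℕ) : Prop :=
  IsLeast {m : ℕ | ∃ w : Pairs π n, ¬ Detects Q (errorOp ξ w) ∧ wtM w = m} d

end MannheimQuantum

/-! The code is spanned by the states `∑_{h ∈ H} |x + h⟩`, one for each coset of `H = C₂` in
`G = C₁`. The operator `X_a Z_b` multiplies such a state by the character `u ↦ ξ ^ μ⁻¹(b · u)` and
moves it to the coset shifted by `a`. If the character is nontrivial on `H`, its sum over a coset
vanishes; if `a ∉ G`, the shifted cosets are orthogonal to the code; and if `a ∈ H` and the
character is trivial on `G`, the operator fixes the code pointwise. These are exactly the errors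
outside `C^{⊥*} \ C`. An error inside `C^{⊥*} \ C` is already not detected on the span of two of the
states, `H` and `g + H`, so every set of cosets containing these two spans a code of the same
minimum distance. -/

namespace MannheimQuantum

section Detection

open Submodule

variable {𝕜 V : Type*} [RCLike 𝕜] [NormedAddCommGroup V] [InnerProductSpace 𝕜 V]

/-- The compression of the operator `E` to the subspace `Q` is a scalar: this is `Detects` in an
arbitrary inner product space. -/
def IsScalarOn (Q : Submodule 𝕜 V) (E : V →ₗ[𝕜] V) : Prop :=
  ∃ c : 𝕜, ∀ x ∈ Q, ∀ y ∈ Q, inner 𝕜 x (E y) = c * inner 𝕜 x y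

theorem isScalarOn_span {S : Set V} {E : V →ₗ[𝕜] V} (c : 𝕜)
    (h : ∀ x ∈ S, ∀ y ∈ S, inner 𝕜 x (E y) = c * inner 𝕜 x y) : IsScalarOn (span 𝕜 S) E := by
  have hinner (x y : V) : inner 𝕜 x ((E - c • LinearMap.id : V →ₗ[𝕜] V) y) = 0 ↔
      inner 𝕜 x (E y) = c * inner 𝕜 x y := by
    simp [inner_sub_right, inner_smul_right, sub_eq_zero]
  have hortho : span 𝕜 S ⟂ (span 𝕜 S).map (E - c • LinearMap.id) := by
    rw [map_span, isOrtho_span]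
    rintro x hx _ ⟨y, hy, rfl⟩
    exact (hinner x y).2 (h x hx y hy)
  exact ⟨c, fun x hx y hy =>
    (hinner x y).1 (isOrtho_iff_inner_eq.1 hortho x hx _ (mem_map_of_mem hy))⟩

end Detection

section CosetCode

variable {A : Type*} [AddCommGroup A] {H G : AddSubgroup A}

/-- The Weyl operator `|u⟩ ↦ χ(u) |a + u⟩` on the functions on a finite abelian group. -/
noncomputable def weylOp (a : A) (χ : AddChar A ℂ) :
    EuclideanSpace ℂ A →ₗ[ℂ] EuclideanSpace ℂ A where
  toFun ψ := WithLp.toLp 2 fun u => χ (u - a) * ψ (u - a)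
  map_add' ψ φ := by ext u; simp [mul_add]
  map_smul' c ψ := by ext u; simp [mul_left_comm]

theorem weylOp_apply (a : A) (χ : AddChar A ℂ) (ψ : EuclideanSpace ℂ A) (u : A) :
    weylOp a χ ψ u = χ (u - a) * ψ (u - a) := rfl

/-- The labels `(a, χ)` of the Weyl operators that preserve the span of the states of the cosets of
`H` in `G` without acting on it as a scalar. In coding terms these are the elements of
`C^{⊥*} \ C`. -/
def IsLogicalError (H G : AddSubgroup A) (a : A) (χ : AddChar A ℂ) : Prop :=
  (a ∈ G ∧ ∀ h ∈ H, χ h = 1) ∧ ¬(a ∈ H ∧ ∀ g ∈ G, χ g = 1)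

/-- The (unnormalized) sum of the basis states `|u⟩` over the elements `u` of a coset. -/
noncomputable def cosetState (q : A ⧸ H) : EuclideanSpace ℂ A :=
  WithLp.toLp 2 (Set.indicator {u | (u : A ⧸ H) = q} 1)

/-- The quantum code spanned by the states of the cosets in `T`. -/
noncomputable def cosetCode (T : Set (A ⧸ H)) : Submodule ℂ (EuclideanSpace ℂ A) :=
  Submodule.span ℂ (cosetState '' T)

theorem cosetState_of_mem {q : A ⧸ H} {u : A} (h : (u : A ⧸ H) = q) : cosetState q u = 1 :=
  Set.indicator_of_mem (s := {u : A | (u : A ⧸ H) = q}) h 1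

theorem cosetState_of_notMem {q : A ⧸ H} {u : A} (h : (u : A ⧸ H) ≠ q) : cosetState q u = 0 :=
  Set.indicator_of_notMem (s := {u : A | (u : A ⧸ H) = q}) h 1

theorem cosetState_ne_zero (q : A ⧸ H) : cosetState q ≠ 0 := by
  obtain ⟨u, rfl⟩ := QuotientAddGroup.mk_surjective q
  intro h
  have hu := cosetState_of_mem (rfl : (u : A ⧸ H) = u)
  rw [h] at hu
  exact zero_ne_one hu

theorem cosetState_mem_cosetCode {T : Set (A ⧸ H)} {q : A ⧸ H} (h : q ∈ T) :
    cosetState q ∈ cosetCode T :=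
  Submodule.subset_span (Set.mem_image_of_mem _ h)

theorem cosetCode_mono {S T : Set (A ⧸ H)} (h : S ⊆ T) : cosetCode S ≤ cosetCode T :=
  Submodule.span_mono (Set.image_mono h)

theorem weylOp_cosetState {χ : AddChar A ℂ} (hχ : ∀ h ∈ H, χ h = 1) (a x : A) :
    weylOp a χ (cosetState (x : A ⧸ H)) = χ x • cosetState ((x + a : A) : A ⧸ H) := by
  ext u
  have hmem : ((u - a : A) : A ⧸ H) = x ↔ (u : A ⧸ H) = (x + a : A) := by
    rw [QuotientAddGroup.mk_sub, QuotientAddGroup.mk_add, sub_eq_iff_eq_add]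
  rw [weylOp_apply, PiLp.smul_apply, smul_eq_mul]
  by_cases hu : ((u - a : A) : A ⧸ H) = x
  · have hχu : χ (u - a) = χ x := by
      rw [← add_neg_cancel_left x (u - a), AddChar.map_add_eq_mul,
        hχ _ (QuotientAddGroup.eq.1 hu.symm), mul_one]
    rw [cosetState_of_mem hu, cosetState_of_mem (hmem.1 hu), hχu]
  · rw [cosetState_of_notMem hu, cosetState_of_notMem (mt hmem.2 hu), mul_zero, mul_zero]

theorem ncard_map_mk' (H G : AddSubgroup A) :
    (G.map (QuotientAddGroup.mk' H) : Set (A ⧸ H)).ncard = H.relIndex G := by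
  rw [← Nat.card_coe_set_eq, ← QuotientAddGroup.ker_mk' H, AddSubgroup.relIndex_ker,
    QuotientAddGroup.ker_mk']
  rfl

theorem inner_cosetState_of_ne [Fintype A] {q q' : A ⧸ H} (h : q ≠ q') :
    inner ℂ (cosetState q) (cosetState q') = 0 := by
  refine Finset.sum_eq_zero fun u _ => ?_
  by_cases hu : (u : A ⧸ H) = q
  · rw [cosetState_of_notMem (hu ▸ h : (u : A ⧸ H) ≠ q'), inner_zero_right]
  · rw [cosetState_of_notMem hu, inner_zero_left]

theorem linearIndependent_cosetState [Finite A] :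
    LinearIndependent ℂ (cosetState : A ⧸ H → EuclideanSpace ℂ A) :=
  have := Fintype.ofFinite A
  linearIndependent_of_ne_zero_of_inner_eq_zero cosetState_ne_zero
    fun _ _ => inner_cosetState_of_ne

theorem finrank_cosetCode [Finite A] (T : Set (A ⧸ H)) :
    Module.finrank ℂ (cosetCode T) = T.ncard := by
  have := Fintype.ofFinite T
  have hli : LinearIndependent ℂ fun q : T => cosetState q.1 :=
    linearIndependent_cosetState.comp _ Subtype.val_injective
  rw [cosetCode, Set.image_eq_range, finrank_span_eq_card hli, ← Nat.card_eq_fintype_card,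
    Nat.card_coe_set_eq]

variable [Fintype A]

theorem inner_weylOp_cosetState_eq_zero {χ : AddChar A ℂ} (hχ : ¬∀ h ∈ H, χ h = 1) (a : A)
    (q q' : A ⧸ H) : inner ℂ (cosetState q') (weylOp a χ (cosetState q)) = 0 := by
  push Not at hχ
  obtain ⟨h, hh, hχh⟩ := hχ
  have hinv (r : A ⧸ H) (u : A) : cosetState r (u + h) = cosetState r u := by
    have hu : ((u + h : A) : A ⧸ H) = u := QuotientAddGroup.mk_add_of_mem u hh
    by_cases hr : (u : A ⧸ H) = r
    · rw [cosetState_of_mem hr, cosetState_of_mem (hu.trans hr)]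
    · rw [cosetState_of_notMem hr, cosetState_of_notMem (hu ▸ hr)]
  -- The substitution `u ↦ u + h` in the sum defining the inner product multiplies it by `χ h`.
  refine eq_zero_of_mul_eq_self_left hχh ?_
  simp only [PiLp.inner_apply, weylOp_apply]
  rw [Finset.mul_sum]
  conv_rhs => rw [← Equiv.sum_comp (Equiv.addRight h)]
  refine Finset.sum_congr rfl fun u _ => ?_
  simp only [Equiv.coe_addRight, add_sub_right_comm u h a, hinv, AddChar.map_add_eq_mul,
    RCLike.inner_apply]
  ring

theorem isScalarOn_weylOp_of_stabilizer (hHG : H ≤ G) {T : Set (A ⧸ H)}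
    (hT : T ⊆ G.map (QuotientAddGroup.mk' H)) {a : A} {χ : AddChar A ℂ} (ha : a ∈ H)
    (hχ : ∀ g ∈ G, χ g = 1) : IsScalarOn (cosetCode T) (weylOp a χ) := by
  refine isScalarOn_span 1 ?_
  rintro x - _ ⟨q, hq, rfl⟩
  obtain ⟨g, hg, rfl⟩ := hT hq
  have hga : ((g + a : A) : A ⧸ H) = g := QuotientAddGroup.mk_add_of_mem g ha
  rw [QuotientAddGroup.mk'_apply, weylOp_cosetState (fun h hh => hχ h (hHG hh)), hga, hχ g hg,
    one_smul, one_mul]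

theorem isScalarOn_weylOp_of_not_normalizer (hHG : H ≤ G) {T : Set (A ⧸ H)}
    (hT : T ⊆ G.map (QuotientAddGroup.mk' H)) {a : A} {χ : AddChar A ℂ}
    (h : ¬(a ∈ G ∧ ∀ h ∈ H, χ h = 1)) : IsScalarOn (cosetCode T) (weylOp a χ) := by
  refine isScalarOn_span 0 ?_
  rintro _ ⟨q', hq', rfl⟩ _ ⟨q, hq, rfl⟩
  rw [zero_mul]
  by_cases hχ : ∀ h ∈ H, χ h = 1
  · obtain ⟨g', hg', rfl⟩ := hT hq'
    obtain ⟨g, hg, rfl⟩ := hT hq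
    have hne : (g' : A ⧸ H) ≠ (g + a : A) := fun heq => h ⟨?_, hχ⟩
    · simp only [QuotientAddGroup.mk'_apply]
      rw [weylOp_cosetState hχ, inner_smul_right, inner_cosetState_of_ne hne, mul_zero]
    · have hmem : -g' + (g + a) ∈ G := hHG (QuotientAddGroup.eq.1 heq)
      rwa [G.add_mem_cancel_left (neg_mem hg'), G.add_mem_cancel_left hg] at hmem
  · exact inner_weylOp_cosetState_eq_zero hχ a q q'

theorem isScalarOn_weylOp_of_not_isLogicalError (hHG : H ≤ G) {T : Set (A ⧸ H)}
    (hT : T ⊆ G.map (QuotientAddGroup.mk' H)) {a : A} {χ : AddChar A ℂ}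
    (h : ¬IsLogicalError H G a χ) : IsScalarOn (cosetCode T) (weylOp a χ) := by
  by_cases hnorm : a ∈ G ∧ ∀ h ∈ H, χ h = 1
  · obtain ⟨ha, hχ⟩ := not_not.1 (not_and.1 h hnorm)
    exact isScalarOn_weylOp_of_stabilizer hHG hT ha hχ
  · exact isScalarOn_weylOp_of_not_normalizer hHG hT hnorm

theorem IsLogicalError.exists_not_isScalarOn {a : A} {χ : AddChar A ℂ}
    (h : IsLogicalError H G a χ) : ∃ g ∈ G, g ∉ H ∧ ∀ T : Set (A ⧸ H),
      ((0 : A) : A ⧸ H) ∈ T → (g : A ⧸ H) ∈ T → ¬IsScalarOn (cosetCode T) (weylOp a χ) := by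
  obtain ⟨⟨ha, hχ⟩, hnot⟩ := h
  have hself (q : A ⧸ H) : inner ℂ (cosetState q) (cosetState q) ≠ 0 :=
    inner_self_ne_zero.2 (cosetState_ne_zero q)
  by_cases haH : a ∈ H
  · -- `|H⟩` and `|g + H⟩` are eigenvectors with different eigenvalues.
    obtain ⟨g, hg, hχg⟩ : ∃ g ∈ G, χ g ≠ 1 := by
      by_contra! hG
      exact hnot ⟨haH, hG⟩
    refine ⟨g, hg, fun hgH => hχg (hχ g hgH), fun T h0 hgT ⟨c, hc⟩ => hχg ?_⟩
    have eigenvalue (x : A) (hx : (x : A ⧸ H) ∈ T) : χ x = c := by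
      have hxa : ((x + a : A) : A ⧸ H) = x := QuotientAddGroup.mk_add_of_mem x haH
      have := hc _ (cosetState_mem_cosetCode hx) _ (cosetState_mem_cosetCode hx)
      rw [weylOp_cosetState hχ, hxa, inner_smul_right] at this
      exact mul_right_cancel₀ (hself _) this
    rw [eigenvalue g hgT, ← eigenvalue 0 h0, AddChar.map_zero_eq_one]
  · -- `|H⟩` is mapped to the orthogonal state `|a + H⟩`.
    have hne : (a : A ⧸ H) ≠ (0 : A) := fun h0 => haH ((QuotientAddGroup.eq_zero_iff a).1 h0)
    refine ⟨a, ha, haH, fun T h0 haT ⟨c, hc⟩ => hself a ?_⟩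
    have := hc _ (cosetState_mem_cosetCode haT) _ (cosetState_mem_cosetCode h0)
    rwa [weylOp_cosetState hχ, zero_add, AddChar.map_zero_eq_one, one_smul,
      inner_cosetState_of_ne hne, mul_zero] at this

theorem exists_subset_cosets_forall_isLeast {ι α : Type*} [PartialOrder α] (wt : ι → α) (a : ι → A)
    (χ : ι → AddChar A ℂ) (hHG : H ≤ G) {m : ℕ} (hm : m ≤ H.relIndex G)
    (htwo : H.relIndex G ≠ 1 → 2 ≤ m) :
    ∃ T ⊆ (G.map (QuotientAddGroup.mk' H) : Set (A ⧸ H)), T.ncard = m ∧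
      ∀ S, T ⊆ S → S ⊆ G.map (QuotientAddGroup.mk' H) →
        ∀ d, IsLeast (wt '' {i | IsLogicalError H G (a i) (χ i)}) d →
          IsLeast (wt '' {i | ¬IsScalarOn (cosetCode S) (weylOp (a i) (χ i))}) d := by
  rw [← ncard_map_mk'] at hm
  by_cases hd : ∃ d, IsLeast (wt '' {i | IsLogicalError H G (a i) (χ i)}) d
  · obtain ⟨d, hd⟩ := hd
    obtain ⟨i, hi, rfl⟩ := hd.1
    obtain ⟨g, hg, hgH, hnot⟩ := hi.exists_not_isScalarOn
    have hne : ((0 : A) : A ⧸ H) ≠ g := fun h => hgH ((QuotientAddGroup.eq_zero_iff g).1 h.symm)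
    have hpair : {((0 : A) : A ⧸ H), (g : A ⧸ H)} ⊆
        (G.map (QuotientAddGroup.mk' H) : Set (A ⧸ H)) :=
      Set.pair_subset ⟨0, zero_mem G, rfl⟩ ⟨g, hg, rfl⟩
    have hm2 : 2 ≤ m := htwo fun h => hgH (AddSubgroup.relIndex_eq_one.1 h hg)
    obtain ⟨T, hpT, hTG, hcard⟩ :=
      Set.exists_subsuperset_card_eq hpair (by rwa [Set.ncard_pair hne]) hm
    refine ⟨T, hTG, hcard, fun S hTS hSG d' hd' => ?_⟩
    rw [hd'.unique hd]
    have hpS := Set.pair_subset_iff.1 (hpT.trans hTS)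
    refine ⟨Set.mem_image_of_mem wt (hnot S hpS.1 hpS.2), lowerBounds_mono_set ?_ hd.2⟩
    exact Set.image_mono fun j hj =>
      by_contra fun h => hj (isScalarOn_weylOp_of_not_isLogicalError hHG hSG h)
  · obtain ⟨T, -, hTG, hcard⟩ := Set.exists_subsuperset_card_eq (Set.empty_subset _) (by simp) hm
    exact ⟨T, hTG, hcard, fun S _ _ d h => absurd ⟨d, h⟩ hd⟩

end CosetCode

section Character

variable {ι R S M : Type*} [CommRing R] [CommRing S]

theorem isPrimitive_compAddMonoidHom [CommMonoid M] {ψ : AddChar R M} (hψ : ψ.IsPrimitive)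
    (e : S ≃+* R) : (ψ.compAddMonoidHom (e : S →+ R)).IsPrimitive := by
  intro a ha
  obtain ⟨r, hr⟩ := AddChar.ne_one_iff.1 (hψ (e.map_ne_zero_iff.2 ha))
  refine AddChar.ne_one_iff.2 ⟨e.symm r, ?_⟩
  simpa [AddChar.mulShift_apply] using hr

variable [Fintype ι]

/-- The additive character `u ↦ ψ (b · u)` of `R^ι`, the phase of the operator `Z_b`. -/
def dotChar [Monoid M] (ψ : AddChar R M) (b : ι → R) : AddChar (ι → R) M :=
  ψ.compAddMonoidHom (AddMonoidHom.mk' (b ⬝ᵥ ·) (dotProduct_add b))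

theorem dotChar_apply [Monoid M] (ψ : AddChar R M) (b u : ι → R) :
    dotChar ψ b u = ψ (b ⬝ᵥ u) := rfl

theorem dotChar_apply_eq_prod [CommMonoid M] (ψ : AddChar R M) (b u : ι → R) :
    dotChar ψ b u = ∏ i, ψ (b i * u i) :=
  map_prod ψ.toMonoidHom (fun i => Multiplicative.ofAdd (b i * u i)) Finset.univ

theorem forall_dotChar_eq_one_iff [CommMonoid M] {ψ : AddChar R M} (hψ : ψ.IsPrimitive)
    {b : ι → R} {C : Submodule R (ι → R)} :
    (∀ u ∈ C, dotChar ψ b u = 1) ↔ ∀ u ∈ C, b ⬝ᵥ u = 0 := by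
  refine ⟨fun h u hu => ?_, fun h u hu => by rw [dotChar_apply, h u hu, ψ.map_zero_eq_one]⟩
  by_contra hbu
  obtain ⟨r, hr⟩ := AddChar.ne_one_iff.1 (hψ hbu)
  refine hr ?_
  rw [AddChar.mulShift_apply, mul_comm, ← smul_eq_mul, ← dotProduct_smul]
  exact h (r • u) (C.smul_mem r hu)

end Character

section LinearAlgebra

variable {K V V' : Type*} [Field K] [AddCommGroup V] [Module K V] [FiniteDimensional K V]
  [AddCommGroup V'] [Module K V'] [FiniteDimensional K V']

theorem finrank_prod_submodule (A : Submodule K V) (B : Submodule K V') :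
    Module.finrank K (A.prod B) = Module.finrank K A + Module.finrank K B := by
  have hrange : (A.subtype.prodMap B.subtype).range = A.prod B := by
    rw [LinearMap.range_prodMap, Submodule.range_subtype, Submodule.range_subtype]
  rw [← hrange, LinearMap.finrank_range_of_inj, Module.finrank_prod]
  exact A.subtype_injective.prodMap B.subtype_injective

theorem relIndex_toAddSubgroup {A B : Submodule K V} (h : A ≤ B) :
    A.toAddSubgroup.relIndex B.toAddSubgroup =
      Nat.card K ^ (Module.finrank K B - Module.finrank K A) := by
  rw [← (Submodule.submoduleOfEquivOfLe h).finrank_eq, ← Submodule.finrank_quotient]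
  exact Module.natCard_eq_pow_finrank (V := B ⧸ A.submoduleOf B)

theorem nondegenerate_dotProductBilin (K ι : Type*) [Field K] [Fintype ι] :
    LinearMap.BilinForm.Nondegenerate (dotProductBilin K K : LinearMap.BilinForm K (ι → K)) :=
  ⟨dotProduct_eq_zero, fun v hv => dotProduct_eq_zero v fun w => by
    rw [dotProduct_comm]
    exact hv w⟩

end LinearAlgebra

section ResidueField

variable {π : GaussianInt} {p : ℕ}

theorem natCast_norm_eq_zero (hπ : Zsqrtd.norm π = p) : (p : Gres π) = 0 := by
  have hmem : ((p : ℤ) : GaussianInt) ∈ Ideal.span {π} := by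
    rw [← hπ, Zsqrtd.norm_eq_mul_conj]
    exact Ideal.mul_mem_right _ _ (Ideal.mem_span_singleton_self π)
  simpa using Ideal.Quotient.eq_zero_iff_mem.2 hmem

theorem nontrivial_gres (hp : p.Prime) (hπ : Zsqrtd.norm π = p) : Nontrivial (Gres π) := by
  rw [Ideal.Quotient.nontrivial_iff, Ne, Ideal.span_singleton_eq_top, ← Zsqrtd.norm_eq_one_iff, hπ,
    Int.natAbs_natCast]
  exact hp.ne_one

theorem charP_gres (hp : p.Prime) (hπ : Zsqrtd.norm π = p) : CharP (Gres π) p :=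
  have := nontrivial_gres hp hπ
  (CharP.charP_iff_prime_eq_zero hp).2 (natCast_norm_eq_zero hπ)

/-- The canonical isomorphism `μ : F_p → G_π`, whose inverse on least representatives is `muInv`. -/
noncomputable def zmodEquivGres (hp : p.Prime) (hπ : Zsqrtd.norm π = p) : ZMod p ≃+* Gres π :=
  have := Fact.mk hp
  have := nontrivial_gres hp hπ
  have := charP_gres hp hπ
  RingEquiv.ofBijective (ZMod.castHom dvd_rfl (Gres π)) ⟨RingHom.injective _, fun x =>
    ⟨(muInv x : ZMod p), by rw [map_natCast, natCast_muInv hp hπ]⟩⟩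

theorem zmodEquivGres_symm_apply (hp : p.Prime) (hπ : Zsqrtd.norm π = p) (x : Gres π) :
    (zmodEquivGres hp hπ).symm x = (muInv x : ZMod p) := by
  rw [RingEquiv.symm_apply_eq, map_natCast, natCast_muInv hp hπ]

theorem isMaximal_span (hp : p.Prime) (hπ : Zsqrtd.norm π = p) : (Ideal.span {π}).IsMaximal :=
  have := Fact.mk hp
  Ideal.Quotient.maximal_of_isField _
    ((zmodEquivGres hp hπ).symm.toMulEquiv.isField (Field.toIsField (ZMod p)))

theorem natCard_gres (hp : p.Prime) (hπ : Zsqrtd.norm π = p) : Nat.card (Gres π) = p := by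
  rw [← Nat.card_congr (zmodEquivGres hp hπ).toEquiv, Nat.card_zmod]

theorem exists_isPrimitive_eq_pow_muInv (hp : p.Prime) (hπ : Zsqrtd.norm π = p) {ξ : ℂ}
    (hξ : IsPrimitiveRoot ξ p) :
    ∃ ψ : AddChar (Gres π) ℂ, ψ.IsPrimitive ∧ ∀ x, ψ x = ξ ^ muInv x := by
  have : NeZero p := ⟨hp.ne_zero⟩
  refine ⟨_, isPrimitive_compAddMonoidHom (AddChar.zmodChar_primitive_of_primitive_root p hξ)
    (zmodEquivGres hp hπ).symm, fun x => ?_⟩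
  calc AddChar.zmodChar p hξ.pow_eq_one ((zmodEquivGres hp hπ).symm x)
    _ = AddChar.zmodChar p hξ.pow_eq_one (muInv x : ZMod p) := by rw [zmodEquivGres_symm_apply]
    _ = ξ ^ muInv x := AddChar.zmodChar_apply' _ _

end ResidueField

section Codes

variable {π : GaussianInt} {n : ℕ}

theorem symplDual_prod (A B : Submodule (Gres π) (Fin n → Gres π)) :
    symplDual (A.prod B) = (dualCode B).prod (dualCode A) := by
  ext w
  refine ⟨fun h => ⟨fun v hv => ?_, fun u hu => ?_⟩, ?_⟩
  · simpa [sympl, dotProduct_comm v] using h (0, v) ⟨zero_mem _, hv⟩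
  · simpa [sympl] using h (u, 0) ⟨hu, zero_mem _⟩
  · rintro ⟨hB, hA⟩ w' ⟨hw'A, hw'B⟩
    rw [sympl, hA _ hw'A, dotProduct_comm, hB _ hw'B, sub_zero]

theorem errorOp_eq_weylOp [NeZero π] {ξ : ℂ} {ψ : AddChar (Gres π) ℂ}
    (hψ : ∀ x, ψ x = ξ ^ muInv x) (w : Pairs π n) :
    errorOp ξ w = weylOp w.1 (dotChar ψ w.2) := by
  ext φ u
  rw [weylOp_apply, dotChar_apply_eq_prod]
  simp only [hψ]
  rfl

theorem prod_dualCode_diff_eq {ψ : AddChar (Gres π) ℂ} (hψ : ψ.IsPrimitive)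
    (C₁ C₂ : Submodule (Gres π) (Fin n → Gres π)) :
    (C₁.prod (dualCode C₂) : Set (Pairs π n)) \ C₂.prod (dualCode C₁) =
      {w | IsLogicalError C₂.toAddSubgroup C₁.toAddSubgroup w.1 (dotChar ψ w.2)} := by
  ext w
  exact (and_congr (and_congr_right' (forall_dotChar_eq_one_iff hψ))
    (not_congr (and_congr_right' (forall_dotChar_eq_one_iff hψ)))).symm

theorem dualCode_eq_orthogonal (A : Submodule (Gres π) (Fin n → Gres π)) :
    dualCode A = LinearMap.BilinForm.orthogonal (dotProductBilin (Gres π) (Gres π)) A := by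
  ext v
  exact forall₂_congr fun u _ => by rw [dotProduct_comm]; rfl

variable [(Ideal.span {π}).IsMaximal]

theorem dualCode_dualCode (A : Submodule (Gres π) (Fin n → Gres π)) :
    dualCode (dualCode A) = A := by
  let _ : Field (Gres π) := Ideal.Quotient.field _
  rw [dualCode_eq_orthogonal, dualCode_eq_orthogonal]
  exact LinearMap.BilinForm.orthogonal_orthogonal (nondegenerate_dotProductBilin _ _)
    (fun u v h => (dotProduct_comm v u).trans h) A

theorem symplDual_prod_dualCode (A B : Submodule (Gres π) (Fin n → Gres π)) :
    symplDual (B.prod (dualCode A)) = A.prod (dualCode B) := by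
  rw [symplDual_prod, dualCode_dualCode]

theorem finrank_dualCode (A : Submodule (Gres π) (Fin n → Gres π)) :
    Module.finrank (Gres π) (dualCode A) = n - Module.finrank (Gres π) A := by
  let _ : Field (Gres π) := Ideal.Quotient.field _
  have h := LinearMap.BilinForm.finrank_orthogonal (nondegenerate_dotProductBilin _ _) A
  rwa [Module.finrank_fin_fun, ← dualCode_eq_orthogonal] at h

theorem finrank_prod_dualCode {A B : Submodule (Gres π) (Fin n → Gres π)} (h : B ≤ A) :
    Module.finrank (Gres π) (A.prod (dualCode B)) =
      Module.finrank (Gres π) (B.prod (dualCode A)) +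
        2 * (Module.finrank (Gres π) A - Module.finrank (Gres π) B) := by
  let _ : Field (Gres π) := Ideal.Quotient.field _
  have hBA : Module.finrank (Gres π) B ≤ Module.finrank (Gres π) A := Submodule.finrank_mono h
  have hA : Module.finrank (Gres π) A ≤ n := (Submodule.finrank_le A).trans_eq (by simp)
  have hsum (A B : Submodule (Gres π) (Fin n → Gres π)) :
      Module.finrank (Gres π) (A.prod (dualCode B)) =
        Module.finrank (Gres π) A + (n - Module.finrank (Gres π) B) :=
    (finrank_prod_submodule A (dualCode B)).trans (congrArg _ (finrank_dualCode B))
  rw [hsum, hsum]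
  omega

end Codes

end MannheimQuantum

open MannheimQuantum in
theorem theorem2_general {α : Type*} [PartialOrder α] {p : ℕ} (hp : p.Prime)
    {π : GaussianInt} [NeZero π] (hπ : Zsqrtd.norm π = (p : ℤ))
    {ξ : ℂ} (hξ : IsPrimitiveRoot ξ p)
    {n : ℕ} (C₁ C₂ : Submodule (Gres π) (Fin n → Gres π))
    {C : Submodule (Gres π) (Pairs π n)} (hC : C = C₂.prod (dualCode C₁))
    (hself : C ≤ symplDual C) (wt : Pairs π n → α) :
    ∃ k : ℕ,
      Module.finrank (Gres π) (symplDual C) = Module.finrank (Gres π) C + 2 * k ∧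
      ∃ Q : Submodule ℂ (HSpace π n),
        Module.finrank ℂ Q = p ^ k ∧
        (∀ d : α, IsLeast (wt '' ((symplDual C : Set (Pairs π n)) \ C)) d →
          IsLeast (wt '' {w | ¬Detects Q (errorOp ξ w)}) d) ∧
        ∃ Q' : Submodule ℂ (HSpace π n), Q' ≤ Q ∧
          Module.finrank ℂ Q' = 2 * k ∧
          (∀ d : α, IsLeast (wt '' ((symplDual C : Set (Pairs π n)) \ C)) d →
            IsLeast (wt '' {w | ¬Detects Q' (errorOp ξ w)}) d) := by
  have := isMaximal_span hp hπ
  obtain ⟨ψ, hψ, hψξ⟩ := exists_isPrimitive_eq_pow_muInv hp hπ hξ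
  subst hC
  rw [symplDual_prod_dualCode] at hself ⊢
  have hle : C₂ ≤ C₁ := fun u hu => (@hself (u, 0) ⟨hu, zero_mem _⟩).1
  set k := Module.finrank (Gres π) C₁ - Module.finrank (Gres π) C₂
  have hcard : C₂.toAddSubgroup.relIndex C₁.toAddSubgroup = p ^ k := by
    let _ : Field (Gres π) := Ideal.Quotient.field _
    rw [relIndex_toAddSubgroup hle, natCard_gres hp hπ]
  have hm : 2 * k ≤ p ^ k :=
    (Nat.mul_le_mul_right k hp.two_le).trans (Nat.mul_le_pow hp.ne_one k)
  have htwo (h : p ^ k ≠ 1) : 2 ≤ 2 * k :=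
    Nat.le_mul_of_pos_right 2 (Nat.pos_of_ne_zero fun hk => h (by rw [hk, pow_zero]))
  obtain ⟨T, hTG, hT, hdist⟩ := exists_subset_cosets_forall_isLeast wt Prod.fst
    (fun w => dotChar ψ w.2) (Submodule.toAddSubgroup_mono hle) (hcard ▸ hm) (hcard ▸ htwo)
  rw [prod_dualCode_diff_eq hψ]
  simp only [errorOp_eq_weylOp hψξ]
  exact ⟨k, finrank_prod_dualCode hle,
    cosetCode (C₁.toAddSubgroup.map (QuotientAddGroup.mk' C₂.toAddSubgroup)),
    (finrank_cosetCode _).trans ((ncard_map_mk' _ _).trans hcard), hdist _ hTG le_rfl,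
    cosetCode T, cosetCode_mono hTG, (finrank_cosetCode T).trans hT, hdist T le_rfl hTG⟩

open MannheimQuantum in
theorem theorem2 (p : ℕ) (hp : p.Prime) (hp4 : p % 4 = 1)
    (π : GaussianInt) [NeZero π] (hπ : Zsqrtd.norm π = (p : ℤ))
    (ξ : ℂ) (hξ : IsPrimitiveRoot ξ p)
    (n : ℕ) (C₁ C₂ : Submodule (Gres π) (Fin n → Gres π))
    (C : Submodule (Gres π) (Pairs π n)) (hC : C = C₂.prod (dualCode C₁))
    (hself : C ≤ symplDual C) :
    ∃ k : ℕ,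
      Module.finrank (Gres π) (symplDual C) = Module.finrank (Gres π) C + 2 * k ∧
      ∃ Q : Submodule ℂ (HSpace π n),
        Module.finrank ℂ Q = p ^ k ∧
        (∀ d : ℕ, IsLeast (wtM '' ((symplDual C : Set (Pairs π n)) \ C)) d →
          HasMinDist ξ Q d) ∧
        ∃ Q' : Submodule ℂ (HSpace π n), Q' ≤ Q ∧
          Module.finrank ℂ Q' = 2 * k ∧
          (∀ d : ℕ, IsLeast (wtM '' ((symplDual C : Set (Pairs π n)) \ C)) d →
            HasMinDist ξ Q' d) :=
  theorem2_general hp hπ hξ C₁ C₂ hC hself wtM
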